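/- For complex $a,q$ and $n\ge 0$ let $(a;q)_n=\prod_{k=0}^{n-1}(1-aq^k)$, and for $|q|<1$ let $(a;q)_\infty=\lim_{n\to\infty}(a;q)_n$; put $1/(q;q)_n=0$ for negative integers $n$. Let ${N\brack k}_q=\frac{(q;q)_N}{(q;q)_k(q;q)_{N-k}}$ if $0\le k\le N$ and ${N\brack k}_q=0$ for all other integers $k$. Let $\left(\frac{\cdot}{3}\right)$ be the Legendre symbol modulo $3$. For $0<|q|<1$ and $z\neq0$ let $$Q(q,z)=(q;q)_\infty(-z;q)_\infty(-q/z;q)_\infty(q/z^2;q^2)_\infty(z^2q;q^2)_\infty .$$ Write $\tilde q=q^2$, $(\tilde q)_n=(\tilde q;\tilde q)_n$ for $n$ an integer or $\infty$, and, for integers $n_1,\dots,n_v\ge0$, $N_i=n_i+n_{i+1}+\cdots+n_v$ $(1\le i\le v)$. (a) For every integer $v\ge1$ and every complex $q$ with $0<|q|<1$, the following series converges absolutely and $$\sum_{n_1,\dots,n_v\ge0}\frac{\tilde q^{\,N_1^2+\cdots+N_v^2}}{(\tilde q)_{n_1}\cdots(\tilde q)_{n_{v-1}}(\tilde q)_{2n_v}}\cdot\frac{(q^3;q^6)_{n_v}}{(q;q^2)_{n_v}}=\frac{Q(q^{12v+6},q^{2v+1})}{(\tilde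 q)_\infty}.$$ (b) (Finite version.) For all integers $v\ge1$, $L\ge0$ and every complex $q$ with $q^k\ne1$ for all $k\ge1$, $$\sum_{n_1,\dots,n_v\ge0}\frac{\tilde q^{\,N_1^2+\cdots+N_v^2}}{(\tilde q)_{n_1}\cdots(\tilde q)_{n_{v-1}}(\tilde q)_{2n_v}}\cdot\frac{(q^3;q^6)_{n_v}}{(q;q^2)_{n_v}}\cdot\frac{(\tilde q)_{2L}}{(\tilde q)_{L-N_1}}=\sum_{j=-\infty}^{\infty}(-1)^j\left(\frac{j+1}{3}\right)q^{(2v+1)j^2}{2L\brack L+j}_{\tilde q},$$ where both sums have only finitely many nonzero terms. (c) (The case $v=1$ of (a), an identity of Ramanujan first proved by Andrews and Berndt.) For every complex $q$ with $0<|q|<1$, $$\sum_{n\ge0}\frac{q^{2n^2}}{(\tilde q)_{2n}}\cdot\frac{(q^3;q^6)_n}{(q;q^2)_n}=\frac{Q(q^{18},q^3)}{(\tilde q)_\infty}.$$ -/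

import Mathlib

namespace QHierarchy

/-- The finite `q`-Pochhammer symbol `(a;q)_n = (1 - a)(1 - a q) ⋯ (1 - a q^(n-1))`. -/
noncomputable def qPoch (a q : ℂ) (n : ℕ) : ℂ :=
  ∏ k ∈ Finset.range n, (1 - a * q ^ k)

/-- The infinite `q`-Pochhammer symbol `(a;q)_∞`, meaningful for `|q| < 1`; see
`tendsto_qPoch` for its description as the limit of `(a;q)_n`. -/
noncomputable def qPochInf (a q : ℂ) : ℂ :=
  ∏' k : ℕ, (1 - a * q ^ k)

/-- For `|q| < 1`, `(a;q)_∞` is the limit of `(a;q)_n` as `n → ∞`. -/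
theorem tendsto_qPoch (a q : ℂ) (hq : ‖q‖ < 1) :
    Filter.Tendsto (qPoch a q) Filter.atTop (nhds (qPochInf a q)) := by
  have hs : Summable fun k : ℕ => ‖-(a * q ^ k)‖ := by
    simp only [norm_neg, norm_mul, norm_pow]
    exact (summable_geometric_of_lt_one (norm_nonneg q) hq).mul_left _
  have hm : Multipliable fun k : ℕ => (1 + -(a * q ^ k)) :=
    multipliable_one_add_of_summable hs
  have h := hm.hasProd.tendsto_prod_nat
  simp only [← sub_eq_add_neg] at h
  exact h

/-- `1 / (q;q)_n` for an integer `n`, with the convention that it is `0` for negative `n`. -/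
noncomputable def qPochRecip (q : ℂ) (n : ℤ) : ℂ :=
  if n < 0 then 0 else 1 / qPoch q q n.toNat

/-- The `q`-binomial coefficient `[N, k]_q = (q;q)_N / ((q;q)_k (q;q)_(N-k))` for `0 ≤ k ≤ N`,
and `0` for every other integer `k`. -/
noncomputable def qBinom (q : ℂ) (N : ℕ) (k : ℤ) : ℂ :=
  if 0 ≤ k ∧ k ≤ N then
    qPoch q q N / (qPoch q q k.toNat * qPoch q q (N - k).toNat)
  else 0

/-- The quintuple product
`Q(q,z) = (q;q)_∞ (-z;q)_∞ (-q/z;q)_∞ (q/z²;q²)_∞ (z²q;q²)_∞`. -/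
noncomputable def quintupleQ (q z : ℂ) : ℂ :=
  qPochInf q q * qPochInf (-z) q * qPochInf (-(q / z)) q
    * qPochInf (q / z ^ 2) (q ^ 2) * qPochInf (z ^ 2 * q) (q ^ 2)

/-- `N_i = n_i + n_(i+1) + ⋯ + n_v` (the indices `1, …, v` are `0, …, v - 1` here). -/
def tailSum {v : ℕ} (n : Fin v → ℕ) (i : Fin v) : ℕ :=
  ∑ j ∈ Finset.Ici i, n j

/-- The first index, `1` in the usual numbering. -/
def firstIdx (v : ℕ) (hv : 1 ≤ v) : Fin v := ⟨0, hv⟩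

/-- The last index, `v` in the usual numbering. -/
def lastIdx (v : ℕ) (hv : 1 ≤ v) : Fin v := ⟨v - 1, Nat.sub_lt hv Nat.one_pos⟩

/-- With `p = q²`, the summand
`p^(N_1² + ⋯ + N_v²) / ((p;p)_(n_1) ⋯ (p;p)_(n_(v-1)) (p;p)_(2 n_v)) · (q³;q⁶)_(n_v) / (q;q²)_(n_v)`.
-/
noncomputable def hierarchyTerm (v : ℕ) (hv : 1 ≤ v) (q : ℂ) (n : Fin v → ℕ) : ℂ :=
  (q ^ 2) ^ (∑ i, tailSum n i ^ 2)
    / ((∏ i ∈ Finset.Iio (lastIdx v hv), qPoch (q ^ 2) (q ^ 2) (n i))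
        * qPoch (q ^ 2) (q ^ 2) (2 * n (lastIdx v hv)))
    * (qPoch (q ^ 3) (q ^ 6) (n (lastIdx v hv)) / qPoch q (q ^ 2) (n (lastIdx v hv)))

/-- The summand of the finite version: `hierarchyTerm` times `(p;p)_(2L) / (p;p)_(L - N_1)`,
where `p = q²`. -/
noncomputable def finiteTerm (v : ℕ) (hv : 1 ≤ v) (q : ℂ) (L : ℕ) (n : Fin v → ℕ) : ℂ :=
  hierarchyTerm v hv q n
    * (qPoch (q ^ 2) (q ^ 2) (2 * L)
        * qPochRecip (q ^ 2) ((L : ℤ) - (tailSum n (firstIdx v hv) : ℤ)))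

/-- The summand `(-1)^j ((j+1)/3) q^((2v+1)j²) [2L, L+j]_(q²)` with the Legendre symbol
modulo `3`. -/
noncomputable def binomialTerm (v : ℕ) (q : ℂ) (L : ℕ) (j : ℤ) : ℂ :=
  (-1 : ℂ) ^ j * (legendreSym 3 (j + 1) : ℂ) * q ^ ((2 * (v : ℤ) + 1) * j ^ 2)
    * qBinom (q ^ 2) (2 * L) ((L : ℤ) + j)

end QHierarchy

namespace QHierarchy


/-! The proof is a Bailey chain with base p = q² and relative parameter 1. Its seed is a "v = 0"
identity, `tsum_thetaCoeff_mul`: a finite Jacobi triple product at a cube root of unity, whose theta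
coefficients are (-1)^j ((j+1)/3) q^(j²). The character appears because its values at three
consecutive integers sum to zero. This turns the recurrence in n for the bilateral sum into
multiplication by 1 + q^(2n+1) + q^(4n+2) = (1 - q^(6n+3))/(1 - q^(2n+1)), up to the factors of
(p;p)_(2n).

One application of the Bailey lemma (`sum_bailey`, a case of q-Chu–Vandermonde) multiplies the j-th
coefficient by p^(j²) and adds one summation variable. After v applications the coefficient carries
q^((2v+1)j²), which gives the finite identity.

For the infinite identity, L → ∞ by dominated convergence leaves a theta series in t = q^(2v+1). The
seed, with t for q and n → ∞, already evaluates that series as a product, and splitting by residue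
classes rewrites the product as Q(t⁶, t). No infinite triple or quintuple product identity is used
as input. -/

/-! ### Finite Pochhammer symbols and their reciprocals. -/

theorem qPoch_zero (a q : ℂ) : qPoch a q 0 = 1 := by simp [qPoch]

theorem qPoch_succ (a q : ℂ) (n : ℕ) :
    qPoch a q (n + 1) = qPoch a q n * (1 - a * q ^ n) := by
  simp [qPoch, Finset.prod_range_succ]

theorem qPochRecip_natCast (q : ℂ) (n : ℕ) : qPochRecip q n = 1 / qPoch q q n := by
  simp [qPochRecip]

theorem qPochRecip_of_neg (q : ℂ) {n : ℤ} (hn : n < 0) : qPochRecip q n = 0 := by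
  simp [qPochRecip, hn]

theorem qPochRecip_natCast_sub (q : ℂ) {m n : ℕ} (h : m ≤ n) :
    qPochRecip q ((n : ℤ) - m) = 1 / qPoch q q (n - m) := by
  rw [← qPochRecip_natCast, Nat.cast_sub h]

theorem qPoch_ne_zero_of_mul_pow_ne_one {a q : ℂ} (h : ∀ k : ℕ, a * q ^ k ≠ 1) (n : ℕ) :
    qPoch a q n ≠ 0 := by
  rw [qPoch, Finset.prod_ne_zero_iff]
  intro k _
  exact sub_ne_zero.2 (h k).symm

/-- At m = -1 the factor 1 - q^0 vanishes, so the convention for negative indices is compatible with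
the recurrence. Bilateral sums can then be handled without boundary cases. -/
theorem qPochRecip_eq_mul {q : ℂ} (h : ∀ n, qPoch q q n ≠ 0) (m : ℤ) :
    qPochRecip q m = (1 - q ^ (m + 1)) * qPochRecip q (m + 1) := by
  rcases lt_trichotomy m (-1) with hm | rfl | hm
  · rw [qPochRecip_of_neg q (by omega), qPochRecip_of_neg q (by omega), mul_zero]
  · simp [qPochRecip]
  · obtain ⟨n, rfl⟩ := Int.eq_ofNat_of_zero_le (show 0 ≤ m by omega)
    have h1 := h (n + 1)
    rw [← Nat.cast_succ, qPochRecip_natCast, qPochRecip_natCast, zpow_natCast]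
    rw [qPoch_succ] at h1 ⊢
    have h2 := right_ne_zero_of_mul h1
    have h3 := h n
    rw [pow_succ']
    field_simp

/-! ### q-Chu–Vandermonde and the Bailey lemma. -/

/-- A form of the `q`-Chu–Vandermonde sum. -/
theorem sum_qVandermonde {p : ℂ} (hp : ∀ n, qPoch p p n ≠ 0) (M m : ℕ) :
    ∑ s ∈ Finset.range (M + 1),
        p ^ (s * (s + m)) / (qPoch p p (M - s) * qPoch p p s * qPoch p p (s + m))
      = 1 / (qPoch p p M * qPoch p p (M + m)) := by
  induction M generalizing m with
  | zero => simp [qPoch_zero]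
  | succ M ih =>
    -- Split 1 - p^(M+1) = (1 - p^(M+1-s)) + p^(M+1-s) (1 - p^s). The first piece lowers M; the
    -- second cancels a factor of (p;p)_s and, after s ↦ s + 1, also raises m. Hence the induction
    -- keeps m general.
    have key : (1 - p ^ (M + 1)) * ∑ s ∈ Finset.range (M + 1 + 1),
        p ^ (s * (s + m)) / (qPoch p p (M + 1 - s) * qPoch p p s * qPoch p p (s + m))
        = (∑ s ∈ Finset.range (M + 1),
            p ^ (s * (s + m)) / (qPoch p p (M - s) * qPoch p p s * qPoch p p (s + m)))
          + p ^ (M + m + 1) * ∑ s ∈ Finset.range (M + 1),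
            p ^ (s * (s + (m + 1))) /
              (qPoch p p (M - s) * qPoch p p s * qPoch p p (s + (m + 1))) := by
      have h1 : ∀ s ∈ Finset.range (M + 1 + 1), (1 - p ^ (M + 1)) *
          (p ^ (s * (s + m)) / (qPoch p p (M + 1 - s) * qPoch p p s * qPoch p p (s + m)))
          = (1 - p ^ (M + 1 - s)) * (p ^ (s * (s + m)) /
              (qPoch p p (M + 1 - s) * qPoch p p s * qPoch p p (s + m)))
            + p ^ (M + 1 - s) * (1 - p ^ s) * (p ^ (s * (s + m)) /
              (qPoch p p (M + 1 - s) * qPoch p p s * qPoch p p (s + m))) := by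
        intro s hs
        have : p ^ (M + 1) = p ^ (M + 1 - s) * p ^ s := by
          rw [← pow_add]; congr 1; have := Finset.mem_range.1 hs; omega
        rw [this]; ring
      rw [Finset.mul_sum, Finset.sum_congr rfl h1, Finset.sum_add_distrib]
      congr 1
      · rw [Finset.sum_range_succ]
        simp only [Nat.sub_self, pow_zero, sub_self, zero_mul, add_zero]
        refine Finset.sum_congr rfl fun s hs => ?_
        have hs' : M + 1 - s = M - s + 1 := by have := Finset.mem_range.1 hs; omega
        have h1 := hp (M - s + 1)
        rw [hs']
        rw [qPoch_succ, ← pow_succ'] at h1 ⊢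
        have h2 := right_ne_zero_of_mul h1
        have h3 := hp (M - s)
        have h4 := hp s
        have h5 := hp (s + m)
        field_simp
      · rw [Finset.sum_range_succ']
        simp only [pow_zero, sub_self, mul_zero, zero_mul, add_zero, Finset.mul_sum]
        refine Finset.sum_congr rfl fun s hs => ?_
        have hs' : M + 1 - (s + 1) = M - s := by omega
        have h1 := hp (s + 1)
        rw [hs', show s + 1 + m = s + (m + 1) by ring]
        rw [qPoch_succ, ← pow_succ'] at h1 ⊢
        have h2 := right_ne_zero_of_mul h1
        have h3 := hp (M - s)
        have h4 := hp s
        have h5 := hp (s + (m + 1))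
        have h6 : p ^ (M - s) * p ^ ((s + 1) * (s + (m + 1)))
            = p ^ (M + m + 1) * p ^ (s * (s + (m + 1))) := by
          obtain ⟨d, rfl⟩ : ∃ d, M = s + d := ⟨M - s, by have := Finset.mem_range.1 hs; omega⟩
          rw [← pow_add, ← pow_add]; congr 1
          rw [Nat.add_sub_cancel_left]; ring
        field_simp
        linear_combination h6
    rw [ih, ih] at key
    have h1 := hp (M + 1)
    have h3 := hp (M + m + 1)
    have e1 : M + 1 + m = M + m + 1 := by ring
    have e2 : M + (m + 1) = M + m + 1 := by ring
    rw [e1]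
    rw [e2] at key
    rw [qPoch_succ, ← pow_succ'] at h1 h3
    have h2 := right_ne_zero_of_mul h1
    have h4 := right_ne_zero_of_mul h3
    have h5 := hp M
    have h6 := hp (M + m)
    apply mul_left_cancel₀ h2
    rw [key, qPoch_succ, qPoch_succ, ← pow_succ', ← pow_succ']
    field_simp
    ring

/-- The Bailey lemma with relative parameter `1` and both free parameters sent to infinity. -/
theorem sum_bailey {p : ℂ} (hp : ∀ n, qPoch p p n ≠ 0) {K L : ℕ} (hK : L < K) (j : ℤ) :
    ∑ r ∈ Finset.range K,
        p ^ (r ^ 2) * qPochRecip p ((L : ℤ) - r) * (qPochRecip p (r - j) * qPochRecip p (r + j))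
      = p ^ (j.natAbs ^ 2) * (qPochRecip p (L - j) * qPochRecip p (L + j)) := by
  wlog hj : 0 ≤ j generalizing j
  · have := this (-j) (by omega)
    simpa [sub_neg_eq_add, ← sub_eq_add_neg, mul_comm (qPochRecip p (_ - j))] using this
  obtain ⟨j, rfl⟩ := Int.eq_ofNat_of_zero_le hj
  rw [Int.natAbs_natCast]
  by_cases hLj : L < j
  · rw [qPochRecip_of_neg p (show (L : ℤ) - j < 0 by omega)]
    rw [zero_mul, mul_zero]
    refine Finset.sum_eq_zero fun r _ => ?_
    by_cases hr : r < j
    · rw [qPochRecip_of_neg p (show (r : ℤ) - j < 0 by omega)]; ring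
    · rw [qPochRecip_of_neg p (show (L : ℤ) - r < 0 by omega)]; ring
  -- With r = j + s and L = j + M this is q-Chu–Vandermonde at m = 2j, since r² = j² + s(s + 2j).
  obtain ⟨M, rfl⟩ := Nat.exists_eq_add_of_le (not_lt.1 hLj)
  have hV := sum_qVandermonde hp M (2 * j)
  have e1 : ((j + M : ℕ) : ℤ) - j = M := by push_cast; ring
  have e2 : ((j + M : ℕ) : ℤ) + j = (M + 2 * j : ℕ) := by push_cast; ring
  rw [e1, e2, qPochRecip_natCast, qPochRecip_natCast, div_mul_div_comm, one_mul, ← hV,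
    Finset.mul_sum]
  symm
  refine Finset.sum_bij_ne_zero (fun s _ _ => j + s) ?_ ?_ ?_ ?_
  · intro s hs _
    simp only [Finset.mem_range] at hs ⊢
    omega
  · intro a _ _ b _ _ h
    exact Nat.add_left_cancel h
  · intro r hr hne
    have h1 : j ≤ r := by
      by_contra h
      exact hne (by rw [qPochRecip_of_neg p (show (r : ℤ) - j < 0 by omega)]; ring)
    have h2 : r ≤ j + M := by
      by_contra h
      exact hne (by
        rw [qPochRecip_of_neg p (show ((j + M : ℕ) : ℤ) - r < 0 by push_cast; omega)]; ring)
    refine ⟨r - j, Finset.mem_range.2 (by omega), ?_, by omega⟩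
    obtain ⟨s, rfl⟩ := Nat.exists_eq_add_of_le h1
    rw [Nat.add_sub_cancel_left]
    -- The value p = 0 is allowed, so this must come from the nonvanishing of the term itself.
    have hp0 : p ^ ((j + s) ^ 2) ≠ 0 := fun h => hne (by rw [h]; ring)
    rw [show (j + s) ^ 2 = j ^ 2 + s * (s + 2 * j) by ring, pow_add] at hp0
    exact mul_ne_zero (left_ne_zero_of_mul hp0) (div_ne_zero (right_ne_zero_of_mul hp0)
      (mul_ne_zero (mul_ne_zero (hp _) (hp _)) (hp _)))
  · intro s hs _
    have hs' := Finset.mem_range.1 hs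
    have e3 : ((j + M : ℕ) : ℤ) - (j + s : ℕ) = (M - s : ℕ) := by omega
    have e4 : ((j + s : ℕ) : ℤ) - j = s := by push_cast; ring
    have e5 : ((j + s : ℕ) : ℤ) + j = (s + 2 * j : ℕ) := by push_cast; ring
    rw [e3, e4, e5, qPochRecip_natCast, qPochRecip_natCast, qPochRecip_natCast,
      show (j + s) ^ 2 = j ^ 2 + s * (s + 2 * j) by ring, pow_add]
    simp only [div_eq_mul_inv, mul_inv, one_mul]
    ring

/-! ### The character modulo 3 and the seed identity. -/

/-- The values over a full residue system modulo 3 sum to zero. -/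
theorem legendreSym_three_add (j : ℤ) :
    legendreSym 3 j + legendreSym 3 (j + 2) = -legendreSym 3 (j + 1) := by
  have h : ∀ x : ZMod 3,
      quadraticCharFun (ZMod 3) x + quadraticCharFun (ZMod 3) (x + 2)
        = -quadraticCharFun (ZMod 3) (x + 1) := by decide
  simpa [legendreSym, quadraticChar_apply] using h (j : ZMod 3)

theorem norm_legendreSym_three_le (j : ℤ) : ‖(legendreSym 3 j : ℂ)‖ ≤ 1 := by
  have h : ∀ x : ZMod 3, quadraticCharFun (ZMod 3) x = 0 ∨ quadraticCharFun (ZMod 3) x = 1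
      ∨ quadraticCharFun (ZMod 3) x = -1 := by decide
  have h' : legendreSym 3 j = 0 ∨ legendreSym 3 j = 1 ∨ legendreSym 3 j = -1 := by
    simpa [legendreSym, quadraticChar_apply] using h (j : ZMod 3)
  rcases h' with h | h | h <;> simp [h]

theorem support_qPochRecip_mul_finite (p : ℂ) (n : ℕ) (c : ℤ → ℂ) :
    (Function.support fun j : ℤ =>
      c j * (qPochRecip p (n - j) * qPochRecip p (n + j))).Finite := by
  refine (Set.finite_Icc (-(n : ℤ)) n).subset fun j hj => ?_
  by_contra h
  rw [Set.mem_Icc, not_and_or] at h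
  apply hj
  rcases h with h | h
  · simp only [qPochRecip_of_neg p (show (n : ℤ) + j < 0 by omega), mul_zero]
  · simp only [qPochRecip_of_neg p (show (n : ℤ) - j < 0 by omega), mul_zero, zero_mul]

/-- `(-1)^j ((j+1)/3) x^(j²)`, the summand of a theta series. -/
noncomputable def thetaCoeff (x : ℂ) (j : ℤ) : ℂ :=
  (-1 : ℂ) ^ j * (legendreSym 3 (j + 1) : ℂ) * x ^ (j.natAbs ^ 2)

/-- This is the coefficientwise form of multiplying the finite triple product by (1 - z q^(2n+1))(1
- z⁻¹ q^(2n+1)). Once the reciprocals are written through indices n ± j + 1, it is a polynomial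
identity in x = p^(n-j) and y = p^(n+j). -/
theorem bilateral_recurrence {q : ℂ} (hq0 : q ≠ 0) (hp : ∀ n, qPoch (q ^ 2) (q ^ 2) n ≠ 0)
    (n : ℕ) (e : ℤ → ℂ)
    (he : ∀ j, e j = (-1 : ℂ) ^ j * q ^ (j ^ 2)
      * (qPochRecip (q ^ 2) (n - j) * qPochRecip (q ^ 2) (n + j))) (j : ℤ) :
    (1 - q ^ (4 * n + 2)) * (1 - q ^ (4 * n + 4)) * ((-1 : ℂ) ^ j * q ^ (j ^ 2) *
        (qPochRecip (q ^ 2) ((n + 1 : ℕ) - j) * qPochRecip (q ^ 2) ((n + 1 : ℕ) + j)))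
      = (1 + q ^ (4 * n + 2)) * e j - q ^ (2 * n + 1) * (e (j - 1) + e (j + 1)) := by
  have hp0 : q ^ 2 ≠ 0 := pow_ne_zero _ hq0
  have hR := qPochRecip_eq_mul hp
  have a1 := hR (n - j)
  have a2 := hR (n + j)
  have a3 := hR (n - j - 1)
  have a4 := hR (n + j - 1)
  have hx1 : (q ^ 2) ^ ((n : ℤ) - j + 1) = q ^ 2 * (q ^ 2) ^ ((n : ℤ) - j) := by
    rw [zpow_add_one₀ hp0]; ring
  have hy1 : (q ^ 2) ^ ((n : ℤ) + j + 1) = q ^ 2 * (q ^ 2) ^ ((n : ℤ) + j) := by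
    rw [zpow_add_one₀ hp0]; ring
  have hxy : (q ^ 2) ^ ((n : ℤ) - j) * (q ^ 2) ^ ((n : ℤ) + j) = q ^ (4 * n) := by
    rw [← zpow_add₀ hp0, show (n : ℤ) - j + (n + j) = (2 * n : ℕ) by push_cast; ring,
      zpow_natCast, ← pow_mul]
    congr 1; ring
  have hm1 : q ^ (2 * n + 1) * q ^ ((j - 1) ^ 2)
      = q ^ (j ^ 2) * (q ^ 2 * (q ^ 2) ^ ((n : ℤ) - j)) := by
    rw [← hx1, ← zpow_natCast, ← zpow_natCast, ← zpow_mul, ← zpow_add₀ hq0, ← zpow_add₀ hq0]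
    congr 1; push_cast; ring
  have hm2 : q ^ (2 * n + 1) * q ^ ((j + 1) ^ 2)
      = q ^ (j ^ 2) * (q ^ 2 * (q ^ 2) ^ ((n : ℤ) + j)) := by
    rw [← hy1, ← zpow_natCast, ← zpow_natCast, ← zpow_mul, ← zpow_add₀ hq0, ← zpow_add₀ hq0]
    congr 1; push_cast; ring
  have hs1 : (-1 : ℂ) ^ (j - 1) = -(-1) ^ j := by
    rw [zpow_sub_one₀ (by norm_num)]; norm_num
  have hs2 : (-1 : ℂ) ^ (j + 1) = -(-1) ^ j := by
    rw [zpow_add_one₀ (by norm_num)]; norm_num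
  rw [he, he, he, hs1, hs2]
  rw [show (n : ℤ) - (j - 1) = n - j + 1 by ring, show (n : ℤ) + (j - 1) = n + j - 1 by ring,
    show (n : ℤ) - (j + 1) = n - j - 1 by ring, show (n : ℤ) + (j + 1) = n + j + 1 by ring,
    show ((n + 1 : ℕ) : ℤ) - j = n - j + 1 by push_cast; ring,
    show ((n + 1 : ℕ) : ℤ) + j = n + j + 1 by push_cast; ring]
  rw [a3, a4]
  simp only [sub_add_cancel]
  rw [a1, a2, hx1, hy1]
  have hq4 : q ^ (4 * n + 2) = q ^ 2 * q ^ (4 * n) := by ring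
  have hq44 : q ^ (4 * n + 4) = q ^ 4 * q ^ (4 * n) := by ring
  rw [hq4, hq44, ← hxy]
  set x := (q ^ 2) ^ ((n : ℤ) - j)
  set y := (q ^ 2) ^ ((n : ℤ) + j)
  set A := qPochRecip (q ^ 2) ((n : ℤ) - j + 1)
  set B := qPochRecip (q ^ 2) ((n : ℤ) + j + 1)
  linear_combination (-(-1 : ℂ) ^ j * A * B * (1 - y) * (1 - q ^ 2 * y)) * hm1
    + (-(-1 : ℂ) ^ j * A * B * (1 - x) * (1 - q ^ 2 * x)) * hm2

/-- The case `v = 0` of the finite identity: a finite Jacobi triple product at a cube root of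
unity. -/
theorem tsum_thetaCoeff_mul {q : ℂ} (hq : ∀ k : ℕ, 1 ≤ k → q ^ k ≠ 1)
    (hp : ∀ n, qPoch (q ^ 2) (q ^ 2) n ≠ 0) (n : ℕ) :
    ∑' j : ℤ, thetaCoeff q j * (qPochRecip (q ^ 2) (n - j) * qPochRecip (q ^ 2) (n + j))
      = 1 / qPoch (q ^ 2) (q ^ 2) (2 * n) * (qPoch (q ^ 3) (q ^ 6) n / qPoch q (q ^ 2) n) := by
  -- The finite identity admits q = 0, whereas the recurrence uses negative powers of q.
  by_cases hq0 : q = 0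
  · subst hq0
    have h1 : ∀ m, qPoch 0 0 m = 1 := fun m => by simp [qPoch]
    have h2 : qPochRecip 0 n = 1 := by rw [qPochRecip_natCast, h1, div_one]
    rw [tsum_eq_single 0]
    · simp [thetaCoeff, h1, h2]
    · intro j hj
      simp [thetaCoeff, hj]
  induction n with
  | zero =>
    rw [tsum_eq_single 0]
    · simp [thetaCoeff, qPoch_zero, qPochRecip]
    · intro j hj
      rcases lt_or_gt_of_ne hj with h | h
      · rw [qPochRecip_of_neg _ (show ((0 : ℕ) : ℤ) + j < 0 by simpa using h)]; ring
      · rw [qPochRecip_of_neg _ (show ((0 : ℕ) : ℤ) - j < 0 by simpa using h)]; ring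
  | succ n ih =>
    obtain ⟨e, he⟩ : ∃ e : ℤ → ℂ, ∀ j, e j = (-1 : ℂ) ^ j * q ^ (j ^ 2)
      * (qPochRecip (q ^ 2) (n - j) * qPochRecip (q ^ 2) (n + j)) := ⟨_, fun _ => rfl⟩
    have hsq : ∀ j : ℤ, q ^ (j.natAbs ^ 2) = q ^ (j ^ 2) := fun j => by
      rw [← zpow_natCast]; congr 1; push_cast; exact sq_abs j
    have hfin : ∀ c : ℤ → ℂ, Summable fun j => c j * e j := fun c => by
      have h : (fun j => c j * e j) = fun j => c j * ((-1 : ℂ) ^ j * q ^ (j ^ 2))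
          * (qPochRecip (q ^ 2) (n - j) * qPochRecip (q ^ 2) (n + j)) :=
        funext fun j => by rw [he, mul_assoc, mul_assoc, mul_assoc]
      rw [h]
      exact summable_of_hasFiniteSupport (support_qPochRecip_mul_finite _ n _)
    let χ : ℤ → ℂ := fun j => (legendreSym 3 (j + 1) : ℂ)
    have hχ : ∀ j, χ (j - 1) + χ (j + 1) = -χ j := fun j => by
      have := legendreSym_three_add j
      simp only [χ, sub_add_cancel, add_assoc]
      norm_num
      exact_mod_cast this
    have ih' : ∑' j, χ j * e j =
        1 / qPoch (q ^ 2) (q ^ 2) (2 * n) * (qPoch (q ^ 3) (q ^ 6) n / qPoch q (q ^ 2) n) := by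
      rw [← ih]
      refine tsum_congr fun j => ?_
      rw [he, thetaCoeff, hsq]; ring
    have hl1 : ∑' j, χ j * e (j - 1) = ∑' j, χ (j + 1) * e j := by
      rw [← (Equiv.addRight (1 : ℤ)).tsum_eq]
      simp
    have hl2 : ∑' j, χ j * e (j + 1) = ∑' j, χ (j - 1) * e j := by
      rw [← (Equiv.subRight (1 : ℤ)).tsum_eq]
      simp
    have hs1 : Summable fun j => χ j * e (j - 1) := by
      rw [← (Equiv.addRight (1 : ℤ)).summable_iff]
      simpa [Function.comp_def] using hfin (fun j => χ (j + 1))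
    have hs2 : Summable fun j => χ j * e (j + 1) := by
      rw [← (Equiv.subRight (1 : ℤ)).summable_iff]
      simpa [Function.comp_def] using hfin (fun j => χ (j - 1))
    have hrec : (1 - q ^ (4 * n + 2)) * (1 - q ^ (4 * n + 4)) *
        ∑' j : ℤ, thetaCoeff q j *
          (qPochRecip (q ^ 2) ((n + 1 : ℕ) - j) * qPochRecip (q ^ 2) ((n + 1 : ℕ) + j))
        = (1 + q ^ (2 * n + 1) + q ^ (4 * n + 2)) * ∑' j, χ j * e j := by
      have h1 : ∀ j : ℤ, (1 - q ^ (4 * n + 2)) * (1 - q ^ (4 * n + 4)) * (thetaCoeff q j *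
          (qPochRecip (q ^ 2) ((n + 1 : ℕ) - j) * qPochRecip (q ^ 2) ((n + 1 : ℕ) + j)))
          = (1 + q ^ (4 * n + 2)) * (χ j * e j)
            - q ^ (2 * n + 1) * (χ j * e (j - 1) + χ j * e (j + 1)) := fun j => by
        have := bilateral_recurrence hq0 hp n e he j
        rw [thetaCoeff, hsq]
        simp only [χ]
        linear_combination (legendreSym 3 (j + 1) : ℂ) * this
      rw [← tsum_mul_left, tsum_congr h1, Summable.tsum_sub ((hfin χ).mul_left _)
        ((hs1.add hs2).mul_left _), tsum_mul_left, tsum_mul_left, Summable.tsum_add hs1 hs2,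
        hl1, hl2, ← Summable.tsum_add (hfin _) (hfin _)]
      have h2 : ∑' j, (χ (j + 1) * e j + χ (j - 1) * e j) = -∑' j, χ j * e j := by
        rw [← tsum_neg]
        refine tsum_congr fun j => ?_
        linear_combination e j * hχ j
      rw [h2]; ring
    have hne : ∀ k : ℕ, 1 ≤ k → 1 - q ^ k ≠ 0 := fun k hk => sub_ne_zero.2 (hq k hk).symm
    have n1 := hne (4 * n + 2) (by omega)
    have n2 := hne (4 * n + 4) (by omega)
    have n3 := hne (2 * n + 1) (by omega)
    have n4 : qPoch q (q ^ 2) n ≠ 0 := qPoch_ne_zero_of_mul_pow_ne_one (fun k => by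
      rw [← pow_mul, ← pow_succ']; exact hq _ (by omega)) n
    have n5 := hp (2 * n)
    apply mul_left_cancel₀ (mul_ne_zero n1 n2)
    rw [hrec, ih', show 2 * (n + 1) = 2 * n + 1 + 1 by ring, qPoch_succ _ _ (2 * n + 1),
      qPoch_succ _ _ (2 * n), qPoch_succ _ _ n, qPoch_succ _ _ n]
    have f1 : q ^ 2 * (q ^ 2) ^ (2 * n) = q ^ (4 * n + 2) := by ring
    have f2 : q ^ 2 * (q ^ 2) ^ (2 * n + 1) = q ^ (4 * n + 4) := by ring
    have f3 : q * (q ^ 2) ^ n = q ^ (2 * n + 1) := by ring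
    have f4 : q ^ 3 * (q ^ 6) ^ n = (q ^ (2 * n + 1)) ^ 3 := by ring
    have f5 : q ^ (4 * n + 2) = (q ^ (2 * n + 1)) ^ 2 := by ring
    rw [f1, f2, f3, f4]
    field_simp
    rw [f5]; ring


/-! ### The Bailey chain and the finite identity. -/

theorem qPoch_sq_ne_zero {q : ℂ} (hq : ∀ k : ℕ, 1 ≤ k → q ^ k ≠ 1) (n : ℕ) :
    qPoch (q ^ 2) (q ^ 2) n ≠ 0 :=
  qPoch_ne_zero_of_mul_pow_ne_one (fun k => by
    rw [← pow_mul, ← pow_add]; exact hq _ (by omega)) n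

theorem thetaCoeff_mul_pow (q : ℂ) (v : ℕ) (j : ℤ) :
    thetaCoeff (q ^ (2 * v + 1)) j * (q ^ 2) ^ (j.natAbs ^ 2)
      = thetaCoeff (q ^ (2 * (v + 1) + 1)) j := by
  simp only [thetaCoeff]
  ring

/-- One link of the chain: `sum_bailey` is applied under the j-sum. Terms with r > L vanish, so `f`
matters only up to L. -/
theorem sum_bailey_tsum {q : ℂ} (hp : ∀ n, qPoch (q ^ 2) (q ^ 2) n ≠ 0) (v : ℕ) (f : ℕ → ℂ)
    {K L : ℕ} (hK : L < K)
    (hf : ∀ r ≤ L, f r = ∑' j : ℤ, thetaCoeff (q ^ (2 * v + 1)) j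
      * (qPochRecip (q ^ 2) (r - j) * qPochRecip (q ^ 2) (r + j))) :
    ∑ r ∈ Finset.range K, (q ^ 2) ^ (r ^ 2) * qPochRecip (q ^ 2) ((L : ℤ) - r) * f r
      = ∑' j : ℤ, thetaCoeff (q ^ (2 * (v + 1) + 1)) j
        * (qPochRecip (q ^ 2) (L - j) * qPochRecip (q ^ 2) (L + j)) := by
  have h1 : ∀ r ∈ Finset.range K,
      (q ^ 2) ^ (r ^ 2) * qPochRecip (q ^ 2) ((L : ℤ) - r) * f r
      = ∑' j : ℤ, (q ^ 2) ^ (r ^ 2) * qPochRecip (q ^ 2) ((L : ℤ) - r) *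
        (thetaCoeff (q ^ (2 * v + 1)) j
          * (qPochRecip (q ^ 2) (r - j) * qPochRecip (q ^ 2) (r + j))) := by
    intro r _
    by_cases h : r ≤ L
    · rw [hf r h, tsum_mul_left]
    · simp [qPochRecip_of_neg (q ^ 2) (show (L : ℤ) - r < 0 by omega)]
  rw [Finset.sum_congr rfl h1, ← Summable.tsum_finsetSum]
  · refine tsum_congr fun j => ?_
    rw [← thetaCoeff_mul_pow, mul_assoc, ← sum_bailey hp hK, Finset.mul_sum]
    refine Finset.sum_congr rfl fun r _ => ?_
    ring
  · intro r _
    exact (summable_of_hasFiniteSupport (support_qPochRecip_mul_finite _ r _)).mul_left _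

theorem tailSum_firstIdx {v : ℕ} (hv : 1 ≤ v) (n : Fin v → ℕ) :
    tailSum n (firstIdx v hv) = ∑ i, n i := by
  unfold tailSum
  congr 1
  ext i
  simp [firstIdx, Fin.le_def]

theorem tailSum_cons_zero {w : ℕ} (m : ℕ) (n : Fin w → ℕ) :
    tailSum (Fin.cons m n : Fin (w + 1) → ℕ) 0 = m + ∑ i, n i := by
  have := tailSum_firstIdx (Nat.succ_pos w) (Fin.cons m n : Fin (w + 1) → ℕ)
  rw [Fin.sum_cons] at this
  exact this

theorem tailSum_cons_succ {w : ℕ} (m : ℕ) (n : Fin w → ℕ) (i : Fin w) :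
    tailSum (Fin.cons m n : Fin (w + 1) → ℕ) i.succ = tailSum n i := by
  unfold tailSum
  rw [← Fin.map_succEmb_Ici, Finset.sum_map]
  simp

theorem prod_Iio_lastIdx_cons {w : ℕ} (hw : 1 ≤ w) (h : 1 ≤ w + 1) (m : ℕ) (n : Fin w → ℕ)
    (g : ℕ → ℂ) :
    ∏ i ∈ Finset.Iio (lastIdx (w + 1) h), g ((Fin.cons m n : Fin (w + 1) → ℕ) i)
      = g m * ∏ i ∈ Finset.Iio (lastIdx w hw), g (n i) := by
  have e : Finset.Iio (lastIdx (w + 1) h)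
      = Finset.cons 0 ((Finset.Iio (lastIdx w hw)).map (Fin.succEmb w)) (by simp) := by
    ext i
    refine Fin.cases ?_ (fun i => ?_) i
    · simp [lastIdx, Fin.lt_def]; omega
    · simp [lastIdx, Fin.lt_def]; omega
  rw [e, Finset.prod_cons, Finset.prod_map]
  simp

/-- Prepending a variable changes no later tail sum, so the summand factors. -/
theorem hierarchyTerm_cons {w : ℕ} (hw : 1 ≤ w) (h : 1 ≤ w + 1) (q : ℂ) (m : ℕ)
    (n : Fin w → ℕ) :
    hierarchyTerm (w + 1) h q (Fin.cons m n : Fin (w + 1) → ℕ)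
      = (q ^ 2) ^ ((m + ∑ i, n i) ^ 2) * (1 / qPoch (q ^ 2) (q ^ 2) m)
        * hierarchyTerm w hw q n := by
  have e : lastIdx (w + 1) h = (lastIdx w hw).succ := by
    ext; simp [lastIdx]; omega
  unfold hierarchyTerm
  rw [prod_Iio_lastIdx_cons hw h m n (qPoch (q ^ 2) (q ^ 2)), Fin.sum_univ_succ,
    tailSum_cons_zero, e]
  simp only [tailSum_cons_succ, Fin.cons_succ, pow_add, div_eq_mul_inv, mul_inv]
  ring

theorem sum_piFinset_cons {w K : ℕ} (F : (Fin (w + 1) → ℕ) → ℂ) :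
    ∑ n ∈ Fintype.piFinset (fun _ : Fin (w + 1) => Finset.range K), F n
      = ∑ n ∈ Fintype.piFinset (fun _ : Fin w => Finset.range K), ∑ m ∈ Finset.range K,
        F (Fin.cons m n) := by
  rw [← Finset.sum_product']
  refine Finset.sum_nbij' (fun n => (Fin.tail n, n 0)) (fun x => Fin.cons x.2 x.1) ?_ ?_ ?_ ?_ ?_
  · intro n hn
    simp only [Fintype.mem_piFinset, Finset.mem_product] at hn ⊢
    exact ⟨fun i => hn i.succ, hn 0⟩
  · intro x hx
    simp only [Fintype.mem_piFinset, Finset.mem_product] at hx ⊢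
    exact Fin.cases hx.2 hx.1
  · intro n _; exact Fin.cons_self_tail n
  · intro x _; simp
  · intro n _; rw [Fin.cons_self_tail]

/-- Shifting the summation index by `N` in a convolution whose summand vanishes outside
`N ≤ r ≤ L`. -/
theorem sum_range_shift (p : ℂ) {K L N : ℕ} (hK : L < K) :
    ∑ m ∈ Finset.range K,
        p ^ ((m + N) ^ 2) * (1 / qPoch p p m) * qPochRecip p ((L : ℤ) - (m + N : ℕ))
      = ∑ r ∈ Finset.range K,
        p ^ (r ^ 2) * qPochRecip p ((L : ℤ) - r) * qPochRecip p ((r : ℤ) - N) := by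
  refine Finset.sum_bij_ne_zero (fun m _ _ => m + N) ?_ ?_ ?_ ?_
  · intro m _ hne
    rw [Finset.mem_range]
    by_contra h
    exact hne (by rw [qPochRecip_of_neg p (by omega), mul_zero])
  · intro a _ _ b _ _ h
    exact Nat.add_right_cancel h
  · intro r hr hne
    have h1 : N ≤ r := by
      by_contra h
      exact hne (by rw [qPochRecip_of_neg p (show (r : ℤ) - N < 0 by omega), mul_zero])
    have hr' := Finset.mem_range.1 hr
    refine ⟨r - N, Finset.mem_range.2 (by omega), ?_, by omega⟩
    rw [Nat.sub_add_cancel h1, ← qPochRecip_natCast_sub p h1]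
    rwa [mul_right_comm]
  · intro m _ _
    rw [qPochRecip_natCast_sub p (Nat.le_add_left N m), Nat.add_sub_cancel]
    ring

/-- Induction on the number of variables. The box size `K` stays fixed while L varies, because the
induction hypothesis is needed at every r ≤ L over the same box. -/
theorem sum_hierarchyTerm {q : ℂ} (hq : ∀ k : ℕ, 1 ≤ k → q ^ k ≠ 1) (w : ℕ)
    (hw : 1 ≤ w + 1) {K L : ℕ} (hK : L < K) :
    ∑ n ∈ Fintype.piFinset (fun _ : Fin (w + 1) => Finset.range K),
        hierarchyTerm (w + 1) hw q n * qPochRecip (q ^ 2) ((L : ℤ) - (∑ i, n i : ℕ))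
      = ∑' j : ℤ, thetaCoeff (q ^ (2 * (w + 1) + 1)) j
        * (qPochRecip (q ^ 2) (L - j) * qPochRecip (q ^ 2) (L + j)) := by
  have hp := qPoch_sq_ne_zero hq
  induction w generalizing L with
  | zero =>
    rw [← sum_bailey_tsum hp 0 (fun r => 1 / qPoch (q ^ 2) (q ^ 2) (2 * r)
      * (qPoch (q ^ 3) (q ^ 6) r / qPoch q (q ^ 2) r)) hK
      (fun r _ => by
        rw [mul_zero, zero_add, pow_one]
        exact (tsum_thetaCoeff_mul hq hp r).symm), sum_piFinset_cons]
    simp only [Fintype.piFinset_of_isEmpty, Finset.univ_unique, Finset.sum_singleton]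
    refine Finset.sum_congr rfl fun r _ => ?_
    have e : lastIdx (0 + 1) hw = 0 := rfl
    have e0 : Finset.Iio (0 : Fin 1) = ∅ := rfl
    rw [hierarchyTerm, e]
    simp only [Fin.sum_univ_succ, Fin.sum_univ_zero, tailSum_cons_zero, Fin.cons_zero, add_zero,
      e0, Finset.prod_empty, one_mul]
    ring
  | succ w ih =>
    rw [← sum_bailey_tsum hp (w + 1)
      (fun r => ∑ n ∈ Fintype.piFinset (fun _ : Fin (w + 1) => Finset.range K),
        hierarchyTerm (w + 1) (Nat.succ_pos w) q n
          * qPochRecip (q ^ 2) ((r : ℤ) - (∑ i, n i : ℕ))) hK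
      (fun r hr => ih (Nat.succ_pos w) (hr.trans_lt hK)), sum_piFinset_cons]
    simp only [Finset.mul_sum]
    rw [Finset.sum_comm (s := Finset.range K)]
    refine Finset.sum_congr rfl fun n _ => ?_
    -- Here r plays the role of N_1 and `N` that of N_2, so that r - N is the new variable.
    have h := sum_range_shift (q ^ 2) (N := ∑ i, n i) hK
    have h1 : ∀ m, hierarchyTerm (w + 1 + 1) hw q (Fin.cons m n : Fin (w + 1 + 1) → ℕ)
        * qPochRecip (q ^ 2)
          ((L : ℤ) - (∑ i, (Fin.cons m n : Fin (w + 1 + 1) → ℕ) i : ℕ))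
        = hierarchyTerm (w + 1) (Nat.succ_pos w) q n *
          ((q ^ 2) ^ ((m + ∑ i, n i) ^ 2) * (1 / qPoch (q ^ 2) (q ^ 2) m)
            * qPochRecip (q ^ 2) ((L : ℤ) - (m + ∑ i, n i : ℕ))) := fun m => by
      rw [hierarchyTerm_cons (Nat.succ_pos w), Fin.sum_cons]
      ring
    simp only [h1]
    rw [← Finset.mul_sum, h, Finset.mul_sum]
    refine Finset.sum_congr rfl fun r _ => ?_
    ring

theorem qBinom_eq (p : ℂ) (L : ℕ) (j : ℤ) :
    qBinom p (2 * L) (L + j)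
      = qPoch p p (2 * L) * (qPochRecip p (L - j) * qPochRecip p (L + j)) := by
  unfold qBinom
  split_ifs with h
  · push_cast at h
    have e : ((2 * L : ℕ) : ℤ) - (L + j) = L - j := by push_cast; ring
    rw [e, qPochRecip, qPochRecip, if_neg (by omega), if_neg (by omega)]
    simp only [div_eq_mul_inv, mul_inv, one_mul]
    ring
  · push_cast at h
    rcases not_and_or.1 h with h | h
    · rw [qPochRecip_of_neg p (show (L : ℤ) + j < 0 by omega)]; ring
    · rw [qPochRecip_of_neg p (show (L : ℤ) - j < 0 by omega)]; ring

theorem binomialTerm_eq (v : ℕ) (q : ℂ) (L : ℕ) (j : ℤ) :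
    binomialTerm v q L j = qPoch (q ^ 2) (q ^ 2) (2 * L) * (thetaCoeff (q ^ (2 * v + 1)) j
      * (qPochRecip (q ^ 2) (L - j) * qPochRecip (q ^ 2) (L + j))) := by
  have e : (2 * (v : ℤ) + 1) * j ^ 2 = ((2 * v + 1) * j.natAbs ^ 2 : ℕ) := by
    push_cast; rw [sq_abs]
  rw [binomialTerm, qBinom_eq, thetaCoeff, e, zpow_natCast, pow_mul]
  ring

theorem support_binomialTerm_finite (v : ℕ) (q : ℂ) (L : ℕ) :
    (Function.support fun j : ℤ => binomialTerm v q L j).Finite := by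
  simp only [binomialTerm_eq, ← mul_assoc (qPoch _ _ _) (thetaCoeff _ _)]
  exact support_qPochRecip_mul_finite _ _ _

theorem support_finiteTerm_subset (v : ℕ) (hv : 1 ≤ v) (q : ℂ) (L : ℕ) :
    (Function.support fun n : Fin v → ℕ => finiteTerm v hv q L n)
      ⊆ Fintype.piFinset (fun _ : Fin v => Finset.range (L + 1)) := by
  intro n hn
  simp only [Finset.mem_coe, Fintype.mem_piFinset, Finset.mem_range]
  intro i
  by_contra h
  apply hn
  have h1 : n i ≤ ∑ i, n i := Finset.single_le_sum (fun _ _ => Nat.zero_le _) (Finset.mem_univ i)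
  simp only [finiteTerm, tailSum_firstIdx]
  rw [qPochRecip_of_neg _ (by omega), mul_zero, mul_zero]

theorem finsum_finiteTerm {v : ℕ} (hv : 1 ≤ v) (L : ℕ) {q : ℂ}
    (hq : ∀ k : ℕ, 1 ≤ k → q ^ k ≠ 1) :
    ∑ᶠ n : Fin v → ℕ, finiteTerm v hv q L n = ∑ᶠ j : ℤ, binomialTerm v q L j := by
  rw [finsum_eq_sum_of_support_subset _ (support_finiteTerm_subset v hv q L),
    ← tsum_eq_finsum (L := .unconditional ℤ) (support_binomialTerm_finite v q L)]
  simp only [binomialTerm_eq]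
  rw [tsum_mul_left]
  obtain ⟨w, rfl⟩ := Nat.exists_eq_add_of_le' hv
  rw [← sum_hierarchyTerm hq w hv (Nat.lt_succ_self L), Finset.mul_sum]
  refine Finset.sum_congr rfl fun n _ => ?_
  rw [finiteTerm, tailSum_firstIdx]
  ring

/-! ### Infinite products, limits and convergence. -/

open Filter Topology


theorem qPochInf_ne_zero {a q : ℂ} (hq : ‖q‖ < 1) (h : ∀ k : ℕ, a * q ^ k ≠ 1) :
    qPochInf a q ≠ 0 := by
  have hs : Summable fun k : ℕ => ‖-(a * q ^ k)‖ := by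
    simp only [norm_neg, norm_mul, norm_pow]
    exact (summable_geometric_of_lt_one (norm_nonneg q) hq).mul_left _
  have := tprod_one_add_ne_zero_of_summable (f := fun k : ℕ => -(a * q ^ k))
    (fun k => by rw [← sub_eq_add_neg]; exact sub_ne_zero.2 (h k).symm) hs
  simpa only [qPochInf, sub_eq_add_neg] using this

theorem pow_ne_one_of_norm_lt_one {q : ℂ} (hq : ‖q‖ < 1) (k : ℕ) (hk : 1 ≤ k) : q ^ k ≠ 1 := by
  intro h
  have h1 : ‖q‖ ^ k = 1 := by rw [← norm_pow, h, norm_one]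
  exact (pow_lt_one₀ (norm_nonneg q) hq (by omega)).ne h1

theorem norm_pow_lt_one {q : ℂ} (hq : ‖q‖ < 1) {k : ℕ} (hk : k ≠ 0) : ‖q ^ k‖ < 1 := by
  rw [norm_pow]; exact pow_lt_one₀ (norm_nonneg q) hq hk

theorem qPochInf_self_ne_zero {q : ℂ} (hq : ‖q‖ < 1) : qPochInf q q ≠ 0 :=
  qPochInf_ne_zero hq fun k => by
    rw [← pow_succ']; exact pow_ne_one_of_norm_lt_one hq _ (by omega)

theorem qPoch_two_mul (a q : ℂ) (n : ℕ) :
    qPoch a q (2 * n) = qPoch a (q ^ 2) n * qPoch (a * q) (q ^ 2) n := by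
  induction n with
  | zero => simp [qPoch_zero]
  | succ n ih =>
    rw [show 2 * (n + 1) = 2 * n + 1 + 1 by ring]
    simp only [qPoch_succ, ih]
    ring

theorem qPoch_three_mul (a q : ℂ) (n : ℕ) :
    qPoch a q (3 * n)
      = qPoch a (q ^ 3) n * qPoch (a * q) (q ^ 3) n * qPoch (a * q ^ 2) (q ^ 3) n := by
  induction n with
  | zero => simp [qPoch_zero]
  | succ n ih =>
    rw [show 3 * (n + 1) = 3 * n + 1 + 1 + 1 by ring]
    simp only [qPoch_succ, ih]
    ring

theorem qPoch_mul_neg (a q : ℂ) (n : ℕ) :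
    qPoch a q n * qPoch (-a) q n = qPoch (a ^ 2) (q ^ 2) n := by
  induction n with
  | zero => simp [qPoch_zero]
  | succ n ih => simp only [qPoch_succ, ← ih]; ring

theorem qPochInf_two_dissection {q : ℂ} (hq : ‖q‖ < 1) (a : ℂ) :
    qPochInf a q = qPochInf a (q ^ 2) * qPochInf (a * q) (q ^ 2) := by
  have h2 := norm_pow_lt_one hq two_ne_zero
  refine tendsto_nhds_unique ((tendsto_qPoch a q hq).comp
    (tendsto_id.const_mul_atTop' (r := 2) two_pos)) ?_
  refine ((tendsto_qPoch a _ h2).mul (tendsto_qPoch (a * q) _ h2)).congr fun n => ?_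
  exact (qPoch_two_mul a q n).symm

theorem qPochInf_three_dissection {q : ℂ} (hq : ‖q‖ < 1) (a : ℂ) :
    qPochInf a q
      = qPochInf a (q ^ 3) * qPochInf (a * q) (q ^ 3) * qPochInf (a * q ^ 2) (q ^ 3) := by
  have h3 := norm_pow_lt_one hq three_ne_zero
  refine tendsto_nhds_unique ((tendsto_qPoch a q hq).comp
    (tendsto_id.const_mul_atTop' (r := 3) three_pos)) ?_
  refine (((tendsto_qPoch a _ h3).mul (tendsto_qPoch (a * q) _ h3)).mul
    (tendsto_qPoch (a * q ^ 2) _ h3)).congr fun n => ?_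
  exact (qPoch_three_mul a q n).symm

theorem qPochInf_mul_neg {q : ℂ} (hq : ‖q‖ < 1) (a : ℂ) :
    qPochInf a q * qPochInf (-a) q = qPochInf (a ^ 2) (q ^ 2) :=
  tendsto_nhds_unique (((tendsto_qPoch a q hq).mul (tendsto_qPoch (-a) q hq)).congr
    (qPoch_mul_neg a q)) (tendsto_qPoch _ _ (norm_pow_lt_one hq two_ne_zero))

theorem qPochInf_odd_ne_zero {t : ℂ} (ht : ‖t‖ < 1) : qPochInf t (t ^ 2) ≠ 0 :=
  qPochInf_ne_zero (norm_pow_lt_one ht two_ne_zero) fun k => by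
    rw [← pow_mul, ← pow_succ']; exact pow_ne_one_of_norm_lt_one ht _ (by omega)

/-- Everything is split into classes: base t² into base t⁶, then (t²;t⁶)_∞ and (t⁴;t⁶)_∞ into base
t¹². The factors at ±t and ±t⁵ pair to (t²;t¹²)_∞ and (t¹⁰;t¹²)_∞. -/
theorem quintupleQ_pow_six {t : ℂ} (ht0 : t ≠ 0) (ht : ‖t‖ < 1) :
    quintupleQ (t ^ 6) t
      = qPochInf (t ^ 2) (t ^ 2) * (qPochInf (t ^ 3) (t ^ 6) / qPochInf t (t ^ 2)) := by
  have h2 := norm_pow_lt_one ht two_ne_zero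
  have h6 : ‖t ^ 6‖ < 1 := norm_pow_lt_one ht (by norm_num)
  have a1 := qPochInf_three_dissection h2 (t ^ 2)
  have a2 := qPochInf_three_dissection h2 t
  have a3 := qPochInf_two_dissection h6 (t ^ 2)
  have a4 := qPochInf_two_dissection h6 (t ^ 4)
  have a5 := qPochInf_mul_neg h6 t
  have a6 := qPochInf_mul_neg h6 (t ^ 5)
  have hne := qPochInf_odd_ne_zero ht
  have d1 : t ^ 6 / t = t ^ 5 := by field_simp
  have d2 : t ^ 6 / t ^ 2 = t ^ 4 := by field_simp
  rw [quintupleQ, d1, d2, ← mul_div_assoc, eq_div_iff hne]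
  ring_nf at a1 a2 a3 a4 a5 a6 ⊢
  rw [a1, a2, a3, a4, ← a5, ← a6]
  ring

/-- The symbols (p;p)_n have a nonzero limit, so their inverses converge and are bounded. The bound
supplies the dominating constants below. -/
theorem exists_norm_qPochRecip_le {p : ℂ} (hp : ‖p‖ < 1) :
    ∃ C, 0 ≤ C ∧ ∀ m : ℤ, ‖qPochRecip p m‖ ≤ C := by
  have h := ((tendsto_qPoch p p hp).inv₀ (qPochInf_self_ne_zero hp)).norm
  obtain ⟨C, hC⟩ := h.bddAbove_range
  have hC' : ∀ n : ℕ, ‖qPochRecip p n‖ ≤ C := fun n => by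
    rw [qPochRecip_natCast, one_div]; exact hC ⟨n, rfl⟩
  have h0 : 0 ≤ C := (norm_nonneg _).trans (hC' 0)
  refine ⟨C, h0, fun m => ?_⟩
  by_cases hm : m < 0
  · rw [qPochRecip_of_neg p hm, norm_zero]; exact h0
  · obtain ⟨n, rfl⟩ := Int.eq_ofNat_of_zero_le (not_lt.1 hm)
    exact hC' n

theorem tendsto_qPochRecip {p : ℂ} (hp : ‖p‖ < 1) (j : ℤ) :
    Tendsto (fun L : ℕ => qPochRecip p (L + j)) atTop (𝓝 (1 / qPochInf p p)) := by
  have h := (tendsto_qPoch p p hp).inv₀ (qPochInf_self_ne_zero hp)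
  rw [← one_div] at h
  have hn : Tendsto (fun L : ℕ => ((L : ℤ) + j).toNat) atTop atTop := by
    refine tendsto_atTop.2 fun b => ?_
    filter_upwards [eventually_ge_atTop (b + j.natAbs)] with L hL
    omega
  refine (h.comp hn).congr' ?_
  filter_upwards [eventually_ge_atTop j.natAbs] with L hL
  rw [qPochRecip, if_neg (by omega), one_div]
  rfl

theorem norm_thetaCoeff_le (t : ℂ) (j : ℤ) : ‖thetaCoeff t j‖ ≤ ‖t‖ ^ (j.natAbs ^ 2) := by
  rw [thetaCoeff, norm_mul, norm_mul, norm_zpow, norm_neg, norm_one, one_zpow, one_mul, norm_pow]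
  exact mul_le_of_le_one_left (by positivity) (norm_legendreSym_three_le _)

theorem summable_norm_thetaCoeff {t : ℂ} (ht : ‖t‖ < 1) :
    Summable fun j : ℤ => ‖thetaCoeff t j‖ := by
  have hg := summable_geometric_of_lt_one (norm_nonneg t) ht
  have h : Summable fun j : ℤ => ‖t‖ ^ j.natAbs :=
    Summable.of_nat_of_neg (by simpa using hg) (by simpa using hg)
  refine h.of_nonneg_of_le (fun _ => norm_nonneg _) fun j => (norm_thetaCoeff_le t j).trans ?_
  exact pow_le_pow_of_le_one (norm_nonneg t) ht.le (Nat.le_self_pow two_ne_zero _)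

theorem tendsto_tsum_thetaCoeff_mul {t p : ℂ} (ht : ‖t‖ < 1) (hp : ‖p‖ < 1) :
    Tendsto (fun L : ℕ => ∑' j : ℤ,
        thetaCoeff t j * (qPochRecip p (L - j) * qPochRecip p (L + j))) atTop
      (𝓝 ((∑' j : ℤ, thetaCoeff t j) * (1 / qPochInf p p * (1 / qPochInf p p)))) := by
  obtain ⟨C, hC0, hC⟩ := exists_norm_qPochRecip_le hp
  rw [← tsum_mul_right]
  refine tendsto_tsum_of_dominated_convergence
    ((summable_norm_thetaCoeff ht).mul_right (C * C)) (fun j => ?_)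
    (Eventually.of_forall fun L j => ?_)
  · exact ((tendsto_qPochRecip hp (-j)).mul (tendsto_qPochRecip hp j)).const_mul _
  · rw [norm_mul, norm_mul]
    gcongr <;> exact hC _

/-- Both sides of the seed identity are passed to the limit n → ∞; one factor 1/(t²;t²)_∞ cancels.
-/
theorem tsum_thetaCoeff {t : ℂ} (ht : ‖t‖ < 1) :
    ∑' j : ℤ, thetaCoeff t j
      = qPochInf (t ^ 2) (t ^ 2) * (qPochInf (t ^ 3) (t ^ 6) / qPochInf t (t ^ 2)) := by
  have hq := pow_ne_one_of_norm_lt_one ht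
  have h2 := norm_pow_lt_one ht two_ne_zero
  have h6 : ‖t ^ 6‖ < 1 := norm_pow_lt_one ht (by norm_num)
  have hl := tendsto_tsum_thetaCoeff_mul ht h2
  have hr : Tendsto (fun n : ℕ => 1 / qPoch (t ^ 2) (t ^ 2) (2 * n)
      * (qPoch (t ^ 3) (t ^ 6) n / qPoch t (t ^ 2) n)) atTop
      (𝓝 (1 / qPochInf (t ^ 2) (t ^ 2) * (qPochInf (t ^ 3) (t ^ 6) / qPochInf t (t ^ 2)))) := by
    refine Tendsto.mul ?_ ((tendsto_qPoch _ _ h6).div (tendsto_qPoch _ _ h2)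
      (qPochInf_odd_ne_zero ht))
    exact tendsto_const_nhds.div ((tendsto_qPoch _ _ h2).comp
      (tendsto_id.const_mul_atTop' (r := 2) two_pos)) (qPochInf_self_ne_zero h2)
  have h := tendsto_nhds_unique hl
    (hr.congr fun n => (tsum_thetaCoeff_mul hq (qPoch_sq_ne_zero hq) n).symm)
  have hne := qPochInf_self_ne_zero h2
  generalize qPochInf (t ^ 3) (t ^ 6) / qPochInf t (t ^ 2) = B at h ⊢
  field_simp at h
  rw [h]

theorem summable_pow_sum {r : ℝ} (h0 : 0 ≤ r) (h1 : r < 1) (v : ℕ) :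
    Summable fun n : Fin v → ℕ => r ^ (∑ i, n i) := by
  induction v with
  | zero => exact Summable.of_finite
  | succ v ih =>
    rw [← (Fin.consEquiv fun _ : Fin (v + 1) => ℕ).summable_iff]
    have := (summable_geometric_of_lt_one h0 h1).mul_of_nonneg ih
      (fun n => pow_nonneg h0 n) (fun n => pow_nonneg h0 _)
    refine this.congr fun x => ?_
    simp [Fin.consEquiv, Fin.sum_univ_succ, pow_add]

theorem sum_le_sum_tailSum_sq {v : ℕ} (n : Fin v → ℕ) : ∑ i, n i ≤ ∑ i, tailSum n i ^ 2 :=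
  Finset.sum_le_sum fun _ _ =>
    (Finset.single_le_sum (f := n) (fun _ _ => Nat.zero_le _) (Finset.mem_Ici.2 le_rfl)).trans
      (Nat.le_self_pow two_ne_zero _)

/-- Since N_i ≥ n_i, the power of p is dominated by a product of geometric series; the remaining
factors are uniformly bounded. -/
theorem summable_norm_hierarchyTerm {v : ℕ} (hv : 1 ≤ v) {q : ℂ} (hq : ‖q‖ < 1) :
    Summable fun n : Fin v → ℕ => ‖hierarchyTerm v hv q n‖ := by
  have h2 := norm_pow_lt_one hq two_ne_zero
  have h6 : ‖q ^ 6‖ < 1 := norm_pow_lt_one hq (by norm_num)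
  obtain ⟨C, hC0, hC⟩ := exists_norm_qPochRecip_le h2
  obtain ⟨D, hD⟩ := (((tendsto_qPoch (q ^ 3) _ h6).div (tendsto_qPoch q _ h2)
      (qPochInf_odd_ne_zero hq)).norm).bddAbove_range
  have hC' : ∀ n : ℕ, ‖(qPoch (q ^ 2) (q ^ 2) n)⁻¹‖ ≤ C := fun n => by
    rw [← one_div, ← qPochRecip_natCast]; exact hC n
  have hD' : ∀ n : ℕ, ‖qPoch (q ^ 3) (q ^ 6) n / qPoch q (q ^ 2) n‖ ≤ D := fun n => hD ⟨n, rfl⟩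
  refine ((summable_pow_sum (norm_nonneg _) h2 v).mul_right
    (C ^ (Finset.Iio (lastIdx v hv)).card * C * D)).of_nonneg_of_le
    (fun _ => norm_nonneg _) fun n => ?_
  rw [hierarchyTerm, div_eq_mul_inv, mul_inv, ← Finset.prod_inv_distrib, norm_mul, norm_mul,
    norm_mul, norm_prod, norm_pow, mul_assoc (‖q ^ 2‖ ^ _)]
  have e1 : ∏ i ∈ Finset.Iio (lastIdx v hv), ‖(qPoch (q ^ 2) (q ^ 2) (n i))⁻¹‖
      ≤ C ^ (Finset.Iio (lastIdx v hv)).card := by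
    rw [← Finset.prod_const]
    exact Finset.prod_le_prod (fun _ _ => norm_nonneg _) fun _ _ => hC' _
  have e2 : ‖q ^ 2‖ ^ (∑ i, tailSum n i ^ 2) ≤ ‖q ^ 2‖ ^ (∑ i, n i) :=
    pow_le_pow_of_le_one (norm_nonneg _) h2.le (sum_le_sum_tailSum_sq n)
  gcongr
  · exact hC' _
  · exact hD' _

theorem hasSum_hierarchyTerm {v : ℕ} (hv : 1 ≤ v) {q : ℂ} (hq0 : 0 < ‖q‖) (hq : ‖q‖ < 1) :
    HasSum (fun n : Fin v → ℕ => hierarchyTerm v hv q n)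
      (quintupleQ (q ^ (12 * v + 6)) (q ^ (2 * v + 1)) / qPochInf (q ^ 2) (q ^ 2)) := by
  have h2 := norm_pow_lt_one hq two_ne_zero
  have ht : ‖q ^ (2 * v + 1)‖ < 1 := norm_pow_lt_one hq (by omega)
  have ht0 : q ^ (2 * v + 1) ≠ 0 := pow_ne_zero _ (norm_pos_iff.1 hq0)
  have hs := summable_norm_hierarchyTerm hv hq
  obtain ⟨C, hC0, hC⟩ := exists_norm_qPochRecip_le h2
  have hl : Tendsto (fun L : ℕ => ∑' n : Fin v → ℕ,
      hierarchyTerm v hv q n * qPochRecip (q ^ 2) ((L : ℤ) - (∑ i, n i : ℕ))) atTop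
      (𝓝 ((∑' n : Fin v → ℕ, hierarchyTerm v hv q n) * (1 / qPochInf (q ^ 2) (q ^ 2)))) := by
    rw [← tsum_mul_right]
    refine tendsto_tsum_of_dominated_convergence (hs.mul_right C) (fun n => ?_)
      (Eventually.of_forall fun L n => ?_)
    · exact (tendsto_qPochRecip h2 (-((∑ i, n i : ℕ) : ℤ))).const_mul _
    · rw [norm_mul]
      gcongr
      exact hC _
  have hfin : ∀ L : ℕ, ∑' n : Fin v → ℕ,
      hierarchyTerm v hv q n * qPochRecip (q ^ 2) ((L : ℤ) - (∑ i, n i : ℕ))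
      = ∑' j : ℤ, thetaCoeff (q ^ (2 * v + 1)) j
        * (qPochRecip (q ^ 2) (L - j) * qPochRecip (q ^ 2) (L + j)) := fun L => by
    obtain ⟨w, rfl⟩ := Nat.exists_eq_add_of_le' hv
    rw [← sum_hierarchyTerm (pow_ne_one_of_norm_lt_one hq) w hv (Nat.lt_succ_self L)]
    refine tsum_eq_sum fun n hn => ?_
    have hn' : ∃ i, L < n i := by
      simpa [Fintype.mem_piFinset, Nat.succ_le_iff] using hn
    obtain ⟨i, hi⟩ := hn'
    have h1 : n i ≤ ∑ i, n i :=
      Finset.single_le_sum (fun _ _ => Nat.zero_le _) (Finset.mem_univ i)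
    rw [qPochRecip_of_neg _ (by omega), mul_zero]
  have h := tendsto_nhds_unique hl
    ((tendsto_tsum_thetaCoeff_mul ht h2).congr fun L => (hfin L).symm)
  have hne := qPochInf_self_ne_zero h2
  rw [← mul_assoc] at h
  -- The limit has one factor 1/(p;p)_∞ on the left and two on the right; one remains.
  have h' := mul_right_cancel₀ (one_div_ne_zero hne) h
  have e6 : q ^ (12 * v + 6) = (q ^ (2 * v + 1)) ^ 6 := by ring
  rw [e6, quintupleQ_pow_six ht0 ht, ← tsum_thetaCoeff ht, div_eq_mul_one_div, ← h']
  exact hs.of_norm.hasSum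

theorem hierarchyTerm_one (q : ℂ) (n : ℕ) :
    hierarchyTerm 1 le_rfl q (fun _ => n)
      = q ^ (2 * n ^ 2) / qPoch (q ^ 2) (q ^ 2) (2 * n)
        * (qPoch (q ^ 3) (q ^ 6) n / qPoch q (q ^ 2) n) := by
  have e : lastIdx 1 le_rfl = 0 := rfl
  have e0 : Finset.Iio (0 : Fin 1) = ∅ := rfl
  have e1 : tailSum (fun _ : Fin 1 => n) 0 = n := rfl
  rw [hierarchyTerm, e, e0, Finset.prod_empty, one_mul, Fin.sum_univ_one, e1, ← pow_mul]

end QHierarchy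

theorem mainTheorem10 :
    -- the infinite hierarchy
    (∀ (v : ℕ) (hv : 1 ≤ v) (q : ℂ), 0 < ‖q‖ → ‖q‖ < 1 →
      HasSum (fun n : Fin v → ℕ => QHierarchy.hierarchyTerm v hv q n)
        (QHierarchy.quintupleQ (q ^ (12 * v + 6)) (q ^ (2 * v + 1))
          / QHierarchy.qPochInf (q ^ 2) (q ^ 2))) ∧
    -- the finite version; both sums have only finitely many nonzero terms
    (∀ (v : ℕ) (hv : 1 ≤ v) (L : ℕ) (q : ℂ), (∀ k : ℕ, 1 ≤ k → q ^ k ≠ 1) →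
      (Function.support fun n : Fin v → ℕ => QHierarchy.finiteTerm v hv q L n).Finite ∧
      (Function.support fun j : ℤ => QHierarchy.binomialTerm v q L j).Finite ∧
      ∑ᶠ n : Fin v → ℕ, QHierarchy.finiteTerm v hv q L n
        = ∑ᶠ j : ℤ, QHierarchy.binomialTerm v q L j) ∧
    -- the case `v = 1` of the infinite hierarchy
    (∀ q : ℂ, 0 < ‖q‖ → ‖q‖ < 1 →
      HasSum
        (fun n : ℕ =>
          q ^ (2 * n ^ 2) / QHierarchy.qPoch (q ^ 2) (q ^ 2) (2 * n)
            * (QHierarchy.qPoch (q ^ 3) (q ^ 6) n / QHierarchy.qPoch q (q ^ 2) n))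
        (QHierarchy.quintupleQ (q ^ 18) (q ^ 3) / QHierarchy.qPochInf (q ^ 2) (q ^ 2))) := by
  refine ⟨fun v hv q h0 h1 => QHierarchy.hasSum_hierarchyTerm hv h0 h1,
    fun v hv L q hq => ⟨?_, QHierarchy.support_binomialTerm_finite v q L,
      QHierarchy.finsum_finiteTerm hv L hq⟩, fun q h0 h1 => ?_⟩
  · exact (Finset.finite_toSet _).subset (QHierarchy.support_finiteTerm_subset v hv q L)
  · have h := QHierarchy.hasSum_hierarchyTerm le_rfl h0 h1
    rw [← (Equiv.funUnique (Fin 1) ℕ).symm.hasSum_iff] at h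
    exact h.congr_fun fun n => (QHierarchy.hierarchyTerm_one q n).symm
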